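/- Let $\mathcal{H}$ be a Hilbert space of finite dimension $d\ge 1$, let $\mathrm{S}(\mathcal{K})$ denote the set of density operators on a finite-dimensional Hilbert space $\mathcal{K}$, and let $\mathcal{M}=\{M_x\}_{x\in\mathcal{X}}$ be a POVM on $\mathcal{H}$ with finite outcome set $\mathcal{X}$. For $0\le r\le n$ and $\sigma\in \mathrm{S}(\mathcal{H})$, a state $\rho\in \mathrm{S}(\mathcal{H}^{\otimes n})$ is called an $\binom{n}{r}$-almost-iid state in $\sigma$ if there exist a finite-dimensional Hilbert space $\mathcal{E}$, a purification $\theta\in\mathcal{H}\otimes\mathcal{E}$ of $\sigma$ (that is, $\mathrm{tr}_{\mathcal{E}}|\theta\rangle\langle\theta|=\sigma$) and a state $R\in \mathrm{S}((\mathcal{H}\otimes\mathcal{E})^{\otimes n})$ with $\mathrm{tr}_{\mathcal{E}^{\otimes n}}[R]=\rho$ such that (i) $\pi R\pi^\dagger=R$ for every permutation $\pi$ of the $n$ factors $\mathcal{H}\otimes\mathcal{E}$, and (ii) the support $(\ker R)^\perp$ of $R$ is contained in the linear span of all vectors $\pi(\theta^{\otimes (n-r)}\otimes\Omega)$, where $\pi$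 is a permutation of the $n$ factors and $\Omega\in(\mathcal{H}\otimes\mathcal{E})^{\otimes r}$. For $\mathbf{x}=(x_1,\dots,x_n)\in\mathcal{X}^n$ let $\lambda_{\mathbf{x}}(y)=\frac1n|\{i: x_i=y\}|$ for $y\in\mathcal{X}$. Let $\log$ be the logarithm to base $2$, let $h(p)=-p\log p-(1-p)\log(1-p)$ be the binary entropy (with $0\log 0=0$), and let $$f(\varepsilon,r,n)=2\sqrt{\frac{\log(1/\varepsilon)}{n}+\frac{|\mathcal{X}|}{n}\log\Big(\frac n2+1\Big)+h\Big(\frac rn\Big)+\frac{2r}{n}\log d}+\frac{2r}{n},$$ where the square root of a negative number (which can occur only for $\varepsilon>1$, if $r\le n$) is read as $0$. Then the following hold. (a) Let $n\ge 1$ and $r\ge 0$ be integers with $r\le n/2$, let $\sigma\in \mathrm{S}(\mathcal{H})$, let $\rho$ be an $\binom{n}{r}$-almost-iid state in $\sigma$, and let $P_X(x)=\mathrm{tr}[M_x\sigma]$ for $x\in\mathcal{X}$. Then for every $\varepsilon>0$, $$\mathbb{P}_{\mathbf{x}}\big[\|\lambda_{\mathbf{x}}-P_X\|_1>f(\varepsilon,r,n)\big]\le\varepsilon,$$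 where $\mathbf{x}$ is the outcome of the product measurement $\mathcal{M}^{\otimes n}$ applied to $\rho$, that is, $\mathbf{x}$ has probability $\mathrm{tr}[(M_{x_1}\otimes\cdots\otimes M_{x_n})\rho]$. (b) For every $\varepsilon>0$ and every sequence of nonnegative integers $r=r(n)$ with $r(n)=o(n)$, we have $\lim_{n\to\infty}f(\varepsilon,r(n),n)=0$. -/

import Mathlib

open Filter Topology Asymptotics
open scoped ComplexOrder

noncomputable section

namespace AlmostIID

/-- A density matrix on the Hilbert space `ℂ^ι`. -/
def IsDensity {ι : Type*} [Fintype ι] (ρ : Matrix ι ι ℂ) : Prop :=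
  ρ.PosSemidef ∧ ρ.trace = 1

/-- A POVM on `ℂ^ι` with finite outcome set `X`. -/
def IsPOVM {ι X : Type*} [DecidableEq ι] [Fintype X] (M : X → Matrix ι ι ℂ) : Prop :=
  (∀ x, (M x).PosSemidef) ∧ ∑ x, M x = 1

/-- The operator `A 0 ⊗ ⋯ ⊗ A (n-1)` on `(ℂ^ι)^{⊗ n} = ℂ^(ι^n)`. -/
def tensorOp {ι : Type*} {n : ℕ} (A : Fin n → Matrix ι ι ℂ) :
    Matrix (Fin n → ι) (Fin n → ι) ℂ :=
  Matrix.of fun a b => ∏ k, A k (a k) (b k)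

/-- The vector `θ ∈ ℂ^ι ⊗ ℂ^κ` is a purification of `σ`, i.e. `tr_κ |θ⟩⟨θ| = σ`. -/
def IsPurification {ι κ : Type*} [Fintype κ] (σ : Matrix ι ι ℂ)
    (θ : EuclideanSpace ℂ (ι × κ)) : Prop :=
  ∀ a b, ∑ e, θ (a, e) * star (θ (b, e)) = σ a b

/-- The partial trace of an operator on `(ℂ^ι ⊗ ℂ^κ)^{⊗ n}` over the `n` factors `ℂ^κ`. -/
def partialTrace {ι κ : Type*} [Fintype κ] {n : ℕ}
    (R : Matrix (Fin n → ι × κ) (Fin n → ι × κ) ℂ) : Matrix (Fin n → ι) (Fin n → ι) ℂ :=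
  Matrix.of fun a b => ∑ e : Fin n → κ, R (fun k => (a k, e k)) (fun k => (b k, e k))

/-- Invariance of an operator on `(ℂ^κ)^{⊗ n}` under all permutations of the factors,
`π R π† = R`. -/
def IsPermInvariant {κ : Type*} {n : ℕ} (R : Matrix (Fin n → κ) (Fin n → κ) ℂ) : Prop :=
  ∀ π : Equiv.Perm (Fin n), ∀ i j : Fin n → κ, R (i ∘ π) (j ∘ π) = R i j

/-- The action of a permutation on `(ℂ^κ)^{⊗ n}` by permuting the factors. -/
def permVec {κ : Type*} {n : ℕ} (π : Equiv.Perm (Fin n))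
    (ψ : EuclideanSpace ℂ (Fin n → κ)) : EuclideanSpace ℂ (Fin n → κ) :=
  WithLp.toLp 2 fun i => ψ (i ∘ π)

/-- The vector `θ^{⊗ m} ⊗ Ω` of `(ℂ^κ)^{⊗ n}`, where `n = m + k` and `Ω ∈ (ℂ^κ)^{⊗ k}`. -/
def powTensor {κ : Type*} {m k n : ℕ} (h : m + k = n) (θ : EuclideanSpace ℂ κ)
    (Ω : EuclideanSpace ℂ (Fin k → κ)) : EuclideanSpace ℂ (Fin n → κ) :=
  WithLp.toLp 2 fun i =>
    (∏ j : Fin m, θ (i (Fin.cast h (Fin.castAdd k j)))) *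
      Ω (fun j : Fin k => i (Fin.cast h (Fin.natAdd m j)))

/-- The set of all vectors `π (θ^{⊗ m} ⊗ Ω)` of `(ℂ^κ)^{⊗ n}`, where `n = m + k`. -/
def defectVectors {κ : Type*} {m k n : ℕ} (h : m + k = n) (θ : EuclideanSpace ℂ κ) :
    Set (EuclideanSpace ℂ (Fin n → κ)) :=
  {ψ | ∃ (π : Equiv.Perm (Fin n)) (Ω : EuclideanSpace ℂ (Fin k → κ)),
    ψ = permVec π (powTensor h θ Ω)}

/-- The support of an operator, the orthogonal complement of its kernel. -/
def opSupport {κ : Type*} [Fintype κ] [DecidableEq κ] (R : Matrix κ κ ℂ) :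
    Submodule ℂ (EuclideanSpace ℂ κ) :=
  (LinearMap.ker (Matrix.toEuclideanLin R))ᗮ

/-- `ρ` is an `(n choose r)`-almost-iid state in `σ`: for some purification `θ` of `σ` there is an
extension `R` of `ρ` to `(ℂ^ι ⊗ ℂ^e)^{⊗ n}` that is permutation invariant and supported on
the span of the vectors that equal `θ` on `n - r` of the factors. -/
def IsAlmostIID {ι : Type*} [Fintype ι] [DecidableEq ι] (n r : ℕ)
    (σ : Matrix ι ι ℂ) (ρ : Matrix (Fin n → ι) (Fin n → ι) ℂ) : Prop :=
  IsDensity σ ∧ IsDensity ρ ∧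
    ∃ (hr : r ≤ n) (e : ℕ) (θ : EuclideanSpace ℂ (ι × Fin e))
      (R : Matrix (Fin n → ι × Fin e) (Fin n → ι × Fin e) ℂ),
      IsPurification σ θ ∧ IsDensity R ∧ partialTrace R = ρ ∧ IsPermInvariant R ∧
        opSupport R ≤ Submodule.span ℂ (defectVectors (Nat.sub_add_cancel hr) θ)

/-- The outcome distribution `x ↦ tr[M_x σ]` of the measurement `M` in the state `σ`. -/
def outcomeProb {ι X : Type*} [Fintype ι] (M : X → Matrix ι ι ℂ) (σ : Matrix ι ι ℂ) (x : X) : ℝ :=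
  (M x * σ).trace.re

/-- The product measurement `M^{⊗ n}`, with outcomes in `X^n`. -/
def productPOVM {ι X : Type*} (M : X → Matrix ι ι ℂ) (n : ℕ) :
    (Fin n → X) → Matrix (Fin n → ι) (Fin n → ι) ℂ :=
  fun x => tensorOp fun k => M (x k)

/-- The probability of the event `W` when the measurement `M` is applied to the state `σ`. -/
def eventProb {ι X : Type*} [Fintype ι] [Fintype X] (M : X → Matrix ι ι ℂ) (σ : Matrix ι ι ℂ)
    (W : Set X) : ℝ :=
  ∑ x, W.indicator (outcomeProb M σ) x

/-- The frequency distribution (type) of a sequence. -/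
def freq {X : Type*} [DecidableEq X] {n : ℕ} (x : Fin n → X) (y : X) : ℝ :=
  ((Finset.univ.filter fun i => x i = y).card : ℝ) / n

/-- The `ℓ¹` distance of two functions on a finite set. -/
def l1Dist {X : Type*} [Fintype X] (P Q : X → ℝ) : ℝ := ∑ y, |P y - Q y|

/-- The binary entropy function, in bits. -/
def binEntropyBits (x : ℝ) : ℝ := -x * Real.logb 2 x - (1 - x) * Real.logb 2 (1 - x)

/-- The deviation bound, for an alphabet of size `c` and a Hilbert space of dimension `d`. -/
def deviation (c d : ℕ) (ε : ℝ) (r n : ℕ) : ℝ :=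
  2 * √(Real.logb 2 (1 / ε) / n + (c : ℝ) / n * Real.logb 2 ((n : ℝ) / 2 + 1)
      + binEntropyBits ((r : ℝ) / n) + 2 * (r : ℝ) / n * Real.logb 2 d)
    + 2 * (r : ℝ) / n

end AlmostIID

end

open AlmostIID

/-!
Fix a purification `θ` of `σ`, put `P = |θ⟩⟨θ|`, and for `T ⊆ {1, …, n}` let `Q_T` be the tensor
product of `1 - P` at the sites of `T` and `P` elsewhere. The `Q_T` are orthogonal projections
summing to `1`, and `Q_T` kills every vector `π (θ^{⊗ (n - r)} ⊗ Ω)` when `|T| > r`. Hence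
`R = Π R Π` with `Π = ∑_{|T| ≤ r} Q_T`, and the pinching inequality bounds `R` by
`N ∑_{|T| ≤ r} Q_T R Q_T`, where `N` is the number of sets `T` with `|T| ≤ r`.

In the state `Q_T R Q_T` the outcomes at the sites outside `T` are independent with distribution
`P_X`, whatever `R` is. Hoeffding's inequality for each `A ⊆ X` and a union bound over the
`2 ^ |X|` sets `A` control the `ℓ¹` deviation of the type; the at most `r` outcomes inside `T`
move it by at most `2 r / n`. The factor `N` is at most `2 ^ (n h(r / n))` as long as `r ≤ n / 2`.
-/

namespace AlmostIID

section Classical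

variable {α X : Type*} [Fintype X] {P : X → ℝ}

theorem sum_mul_exp_sub_mean_le (hP : P ∈ stdSimplex ℝ X) {f : X → ℝ} {a b : ℝ}
    (hf : ∀ y, f y ∈ Set.Icc a b) (s : ℝ) :
    ∑ y, P y * Real.exp (s * (f y - ∑ z, P z * f z)) ≤ Real.exp (s ^ 2 * (b - a) ^ 2 / 8) := by
  open MeasureTheory ProbabilityTheory in
  let p : PMF X := .ofFintype (fun y => ENNReal.ofReal (P y)) <| by
    rw [← ENNReal.ofReal_sum_of_nonneg fun y _ => hP.1 y, hP.2, ENNReal.ofReal_one]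
  let _ : MeasurableSpace X := ⊤
  have hintegral (g : X → ℝ) : ∫ y, g y ∂p.toMeasure = ∑ y, P y * g y := by
    simp [PMF.integral_eq_sum, p, ENNReal.toReal_ofReal (hP.1 _)]
  have hmgf := (hasSubgaussianMGF_of_mem_Icc (μ := p.toMeasure)
    (measurable_from_top (f := f)).aemeasurable (.of_forall hf)).mgf_le s
  rw [mgf, hintegral, hintegral] at hmgf
  refine hmgf.trans_eq (congrArg Real.exp ?_)
  simp only [NNReal.coe_pow, NNReal.coe_div, coe_nnnorm, NNReal.coe_ofNat, Real.norm_eq_abs,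
    div_pow, sq_abs]
  ring

variable [Fintype α] [DecidableEq α]

/-- Under the (unnormalized) weight `q` on `X^α`, the coordinates in `S` are iid with law `P`.
Factorization is tested on product functions, so that no marginal on `S → X` has to be formed. -/
def IsIIDOn (P : X → ℝ) (S : Finset α) (q : (α → X) → ℝ) : Prop :=
  ∀ w : α → X → ℝ, ∑ x, q x * ∏ k ∈ S, w k (x k) = (∑ x, q x) * ∏ k ∈ S, ∑ y, P y * w k y

theorem IsIIDOn.sum_mul_exp_le {S : Finset α} {q : (α → X) → ℝ} (hq : IsIIDOn P S q)
    (hq0 : ∀ x, 0 ≤ q x) (hP : P ∈ stdSimplex ℝ X) {f : X → ℝ} {a b : ℝ}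
    (hf : ∀ y, f y ∈ Set.Icc a b) (s : ℝ) :
    ∑ x, q x * Real.exp (s * ∑ k ∈ S, (f (x k) - ∑ y, P y * f y)) ≤
      (∑ x, q x) * Real.exp (S.card * (s ^ 2 * (b - a) ^ 2 / 8)) := by
  simp_rw [fun x : α → X => Finset.mul_sum S (fun k => f (x k) - ∑ y, P y * f y) s, Real.exp_sum]
  rw [hq fun _ y => Real.exp (s * (f y - ∑ z, P z * f z)), Finset.prod_const, Real.exp_nat_mul]
  have hmean0 : 0 ≤ ∑ y, P y * Real.exp (s * (f y - ∑ z, P z * f z)) :=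
    Finset.sum_nonneg fun y _ => mul_nonneg (hP.1 y) (Real.exp_nonneg _)
  gcongr
  · exact Finset.sum_nonneg fun x _ => hq0 x
  · exact sum_mul_exp_sub_mean_le hP hf s

theorem IsIIDOn.hoeffding {S : Finset α} {q : (α → X) → ℝ} (hq : IsIIDOn P S q)
    (hq0 : ∀ x, 0 ≤ q x) (hP : P ∈ stdSimplex ℝ X) {f : X → ℝ} {a b : ℝ}
    (hf : ∀ y, f y ∈ Set.Icc a b) {v c : ℝ} (hv0 : 0 < v) (hv : S.card * (b - a) ^ 2 ≤ v)
    (hc : 0 ≤ c) :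
    ∑ x, {x | c ≤ ∑ k ∈ S, (f (x k) - ∑ y, P y * f y)}.indicator q x ≤
      (∑ x, q x) * Real.exp (-(2 * c ^ 2 / v)) := by
  -- The exponent `s ^ 2 * v / 8 - s * c` of the Chernoff bound is minimal at this `s`.
  set s := 4 * c / v with hs
  have hs0 : 0 ≤ s := by positivity
  have hmarkov (x : α → X) : {x | c ≤ ∑ k ∈ S, (f (x k) - ∑ y, P y * f y)}.indicator q x ≤
      Real.exp (-(s * c)) * (q x * Real.exp (s * ∑ k ∈ S, (f (x k) - ∑ y, P y * f y))) := by
    rw [mul_left_comm, ← Real.exp_add]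
    rw [Set.indicator_apply]
    split_ifs with hx
    · have := mul_le_mul_of_nonneg_left hx hs0
      exact le_mul_of_one_le_right (hq0 x) (Real.one_le_exp (by linarith))
    · exact mul_nonneg (hq0 x) (Real.exp_nonneg _)
  calc _ ≤ Real.exp (-(s * c)) *
          ∑ x, q x * Real.exp (s * ∑ k ∈ S, (f (x k) - ∑ y, P y * f y)) := by
        rw [Finset.mul_sum]
        exact Finset.sum_le_sum fun x _ => hmarkov x
    _ ≤ Real.exp (-(s * c)) * ((∑ x, q x) * Real.exp (S.card * (s ^ 2 * (b - a) ^ 2 / 8))) := by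
        gcongr
        exact hq.sum_mul_exp_le hq0 hP hf s
    _ = (∑ x, q x) * Real.exp (s ^ 2 / 8 * (S.card * (b - a) ^ 2) - s * c) := by
        rw [mul_left_comm, ← Real.exp_add]
        ring_nf
    _ ≤ (∑ x, q x) * Real.exp (s ^ 2 / 8 * v - s * c) := by
        gcongr
        exact Finset.sum_nonneg fun x _ => hq0 x
    _ = _ := by
        congr 2
        rw [hs]
        field_simp
        ring

end Classical

section Frequency

variable {X : Type*} {P Q : X → ℝ} {n : ℕ}

theorem mul_freq_eq_sum_single [DecidableEq X] (hn : 0 < n) (x : Fin n → X) (y : X) :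
    n * freq x y = ∑ k, (Pi.single (x k) 1 : X → ℝ) y := by
  simp [freq, mul_div_cancel₀, hn.ne', Pi.single_apply, eq_comm]

variable [Fintype X]

theorem l1Dist_le_two (hP : P ∈ stdSimplex ℝ X) (hQ : Q ∈ stdSimplex ℝ X) : l1Dist P Q ≤ 2 := by
  calc l1Dist P Q ≤ ∑ y, (P y + Q y) := Finset.sum_le_sum fun y _ =>
        abs_sub_le_of_nonneg_of_le (hP.1 y) (le_add_of_nonneg_right (hQ.1 y)) (hQ.1 y)
          (le_add_of_nonneg_left (hP.1 y))
    _ = 2 := by rw [Finset.sum_add_distrib, hP.2, hQ.2, one_add_one_eq_two]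

theorem exists_two_mul_sum_eq_sum_abs {D : X → ℝ} (hD : ∑ y, D y = 0) :
    ∃ A : Finset X, 2 * ∑ y ∈ A, D y = ∑ y, |D y| := by
  refine ⟨Finset.univ.filter (0 ≤ D ·), ?_⟩
  have habs (y : X) : |D y| = 2 * (if 0 ≤ D y then D y else 0) - D y := by
    split_ifs with h
    · rw [abs_of_nonneg h]; ring
    · rw [abs_of_neg (not_le.1 h)]; ring
  simp only [habs, Finset.sum_sub_distrib, hD, ← Finset.mul_sum, Finset.sum_filter, sub_zero]

variable [DecidableEq X]

theorem freq_mem_stdSimplex (hn : 0 < n) (x : Fin n → X) : freq x ∈ stdSimplex ℝ X := by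
  have hn' : (n : ℝ) ≠ 0 := by exact_mod_cast hn.ne'
  refine ⟨fun y => by unfold freq; positivity, mul_left_cancel₀ hn' ?_⟩
  simp only [Finset.mul_sum, mul_freq_eq_sum_single hn]
  rw [Finset.sum_comm]
  simp

theorem mul_l1Dist_freq_le (hn : 0 < n) (hP : P ∈ stdSimplex ℝ X) (x : Fin n → X)
    (S : Finset (Fin n)) :
    n * l1Dist (freq x) P ≤
      ∑ y, |∑ k ∈ S, ((Pi.single (x k) 1 : X → ℝ) y - P y)| + 2 * Sᶜ.card := by
  calc n * l1Dist (freq x) P = ∑ y, |∑ k, ((Pi.single (x k) 1 : X → ℝ) y - P y)| := by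
        rw [l1Dist, Finset.mul_sum]
        refine Finset.sum_congr rfl fun y _ => ?_
        rw [Finset.sum_sub_distrib, ← mul_freq_eq_sum_single hn, Finset.sum_const,
          Finset.card_univ, Fintype.card_fin, nsmul_eq_mul, ← mul_sub, abs_mul, Nat.abs_cast]
    _ ≤ ∑ y, (|∑ k ∈ S, ((Pi.single (x k) 1 : X → ℝ) y - P y)| +
          ∑ k ∈ Sᶜ, |(Pi.single (x k) 1 : X → ℝ) y - P y|) := by
        gcongr with y
        rw [← Finset.sum_add_sum_compl S]
        exact (abs_add_le _ _).trans (by gcongr; exact Finset.abs_sum_le_sum_abs _ _)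
    _ = ∑ y, |∑ k ∈ S, ((Pi.single (x k) 1 : X → ℝ) y - P y)| +
          ∑ k ∈ Sᶜ, l1Dist (Pi.single (x k) 1) P := by
        rw [Finset.sum_add_distrib]
        congr 1
        exact Finset.sum_comm
    _ ≤ _ := by
        gcongr
        rw [mul_comm, ← nsmul_eq_mul]
        exact Finset.sum_le_card_nsmul _ _ _ fun k _ =>
          l1Dist_le_two (single_mem_stdSimplex ℝ _) hP

theorem exists_event_of_lt_l1Dist_freq (hn : 0 < n) (hP : P ∈ stdSimplex ℝ X) {δ : ℝ}
    {x : Fin n → X} {S : Finset (Fin n)} (hx : δ + 2 * Sᶜ.card / n < l1Dist (freq x) P) :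
    ∃ A : Finset X, n * δ / 2 ≤
      ∑ k ∈ S, ((if x k ∈ A then 1 else 0) - ∑ y, P y * if y ∈ A then 1 else 0) := by
  let D (y : X) : ℝ := ∑ k ∈ S, ((Pi.single (x k) 1 : X → ℝ) y - P y)
  have hD : ∑ y, D y = 0 := by
    simp only [D]
    rw [Finset.sum_comm]
    simp [hP.2]
  obtain ⟨A, hA⟩ := exists_two_mul_sum_eq_sum_abs hD
  refine ⟨A, ?_⟩
  have hsum : ∑ k ∈ S, ((if x k ∈ A then 1 else 0) - ∑ y, P y * if y ∈ A then 1 else 0) =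
      ∑ y ∈ A, D y := by
    simp only [D]
    rw [Finset.sum_comm]
    simp [Pi.single_apply]
  have hle := mul_l1Dist_freq_le hn hP x S
  have hlt : n * δ + 2 * Sᶜ.card < n * l1Dist (freq x) P := by
    calc (n : ℝ) * δ + 2 * Sᶜ.card = n * (δ + 2 * Sᶜ.card / n) := by field_simp
      _ < _ := by gcongr
  rw [hsum]
  linarith

theorem IsIIDOn.sum_indicator_l1Dist_freq_le (hn : 0 < n) (hP : P ∈ stdSimplex ℝ X)
    {S : Finset (Fin n)} {q : (Fin n → X) → ℝ} (hq : IsIIDOn P S q) (hq0 : ∀ x, 0 ≤ q x) {δ : ℝ}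
    (hδ : 0 ≤ δ) :
    ∑ x, {x | δ + 2 * Sᶜ.card / n < l1Dist (freq x) P}.indicator q x ≤
      2 ^ Fintype.card X * Real.exp (-(n * δ ^ 2 / 2)) * ∑ x, q x := by
  have hn' : (0 : ℝ) < n := by exact_mod_cast hn
  let overfull (A : Finset X) : Set (Fin n → X) :=
    {x | n * δ / 2 ≤ ∑ k ∈ S, ((if x k ∈ A then 1 else 0) - ∑ y, P y * if y ∈ A then 1 else 0)}
  have hind0 (A : Finset X) : ∀ x, 0 ≤ (overfull A).indicator q x :=
    Set.indicator_nonneg fun x _ => hq0 x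
  have hunion (x : Fin n → X) : {x | δ + 2 * Sᶜ.card / n < l1Dist (freq x) P}.indicator q x ≤
      ∑ A, (overfull A).indicator q x := by
    refine Set.indicator_le' (g := fun x => ∑ A, (overfull A).indicator q x) (fun x hx => ?_)
      (fun x _ => Finset.sum_nonneg fun A _ => hind0 A x) x
    obtain ⟨A, hA⟩ := exists_event_of_lt_l1Dist_freq hn hP hx
    rw [← Set.indicator_of_mem (s := overfull A) hA q]
    exact Finset.single_le_sum (fun A _ => hind0 A x) (Finset.mem_univ A)
  have hevent (A : Finset X) :
      ∑ x, (overfull A).indicator q x ≤ (∑ x, q x) * Real.exp (-(n * δ ^ 2 / 2)) := by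
    have hS : (S.card : ℝ) * (1 - 0) ^ 2 ≤ n := by
      simpa using (Nat.cast_le (α := ℝ)).2 (card_finset_fin_le S)
    refine (hq.hoeffding hq0 hP (f := fun y => if y ∈ A then 1 else 0) (fun y => ?_) hn' hS
      (by positivity)).trans_eq ?_
    · split_ifs <;> simp
    · congr 3
      field_simp
  calc _ ≤ ∑ A, ∑ x, (overfull A).indicator q x := by
        rw [Finset.sum_comm]
        exact Finset.sum_le_sum fun x _ => hunion x
    _ ≤ ∑ _A : Finset X, (∑ x, q x) * Real.exp (-(n * δ ^ 2 / 2)) :=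
        Finset.sum_le_sum fun A _ => hevent A
    _ = _ := by
        rw [Finset.sum_const, Finset.card_univ, Fintype.card_finset, nsmul_eq_mul]
        push_cast
        ring

end Frequency

open Matrix Kronecker

section PosSemidef

variable {m : Type*} [Fintype m]

theorem exists_eq_conjTranspose_mul_self {A : Matrix m m ℂ} (hA : A.PosSemidef) :
    ∃ B : Matrix m m ℂ, A = Bᴴ * B := by
  classical
  open scoped MatrixOrder Matrix.Norms.L2Operator in
  exact CStarAlgebra.nonneg_iff_eq_star_mul_self.mp hA.nonneg

theorem trace_mul_nonneg {A B : Matrix m m ℂ} (hA : A.PosSemidef) (hB : B.PosSemidef) :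
    0 ≤ (A * B).trace := by
  obtain ⟨C, rfl⟩ := exists_eq_conjTranspose_mul_self hB
  rw [← Matrix.mul_assoc, trace_mul_comm, ← Matrix.mul_assoc]
  exact (hA.mul_mul_conjTranspose_same C).trace_nonneg

theorem posSemidef_pinching {τ : Type*} {A : Matrix m m ℂ} (hA : A.PosSemidef) (s : Finset τ)
    (B : τ → Matrix m m ℂ) :
    ((s.card : ℝ) • ∑ t ∈ s, (B t)ᴴ * A * B t -
      (∑ t ∈ s, B t)ᴴ * A * ∑ t ∈ s, B t).PosSemidef := by
  have hsquares : (s.card : ℝ) • ∑ t ∈ s, (B t)ᴴ * A * B t -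
      (∑ t ∈ s, B t)ᴴ * A * ∑ t ∈ s, B t =
        (1 / 2 : ℝ) • ∑ t ∈ s, ∑ u ∈ s, (B t - B u)ᴴ * A * (B t - B u) := by
    have hcross : (∑ t ∈ s, B t)ᴴ * A * ∑ t ∈ s, B t = ∑ t ∈ s, ∑ u ∈ s, (B t)ᴴ * A * B u := by
      simp only [conjTranspose_sum, Finset.sum_mul, Finset.mul_sum]
      exact Finset.sum_comm
    have hcross' : ∑ t ∈ s, ∑ u ∈ s, (B u)ᴴ * A * B t = ∑ t ∈ s, ∑ u ∈ s, (B t)ᴴ * A * B u :=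
      Finset.sum_comm
    simp only [hcross, conjTranspose_sub, Matrix.sub_mul, Matrix.mul_sub, Finset.sum_sub_distrib,
      Finset.sum_const, hcross', ← Finset.smul_sum, ← Nat.cast_smul_eq_nsmul ℝ]
    module
  rw [hsquares]
  exact (posSemidef_sum s fun t _ => posSemidef_sum s fun u _ =>
    hA.conjTranspose_mul_mul_same _).smul (by norm_num)

end PosSemidef

section TensorOp

variable {κ : Type*} {n : ℕ}

theorem tensorOp_mul [Fintype κ] (A B : Fin n → Matrix κ κ ℂ) :
    tensorOp A * tensorOp B = tensorOp fun k => A k * B k := by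
  classical
  ext a c
  simp only [tensorOp, mul_apply, of_apply, Finset.prod_univ_sum, Fintype.piFinset_univ,
    Finset.prod_mul_distrib]

theorem tensorOp_one [DecidableEq κ] : tensorOp (fun _ : Fin n => (1 : Matrix κ κ ℂ)) = 1 := by
  ext a b
  simp only [tensorOp, of_apply, one_apply, funext_iff]
  rw [Finset.prod_ite_zero]
  simp

theorem conjTranspose_tensorOp (A : Fin n → Matrix κ κ ℂ) :
    (tensorOp A)ᴴ = tensorOp fun k => (A k)ᴴ := by
  ext a b
  simp [tensorOp]

theorem tensorOp_smul (c : Fin n → ℂ) (A : Fin n → Matrix κ κ ℂ) :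
    tensorOp (fun k => c k • A k) = (∏ k, c k) • tensorOp A := by
  ext a b
  simp [tensorOp, Finset.prod_mul_distrib]

theorem sum_tensorOp {X : Type*} [Fintype X] (A : Fin n → X → Matrix κ κ ℂ) :
    ∑ x : Fin n → X, tensorOp (fun k => A k (x k)) = tensorOp fun k => ∑ y, A k y := by
  ext a b
  simp only [tensorOp, of_apply, Matrix.sum_apply, Finset.prod_univ_sum, Fintype.piFinset_univ]

theorem sum_tensorOp_ite (A B : Matrix κ κ ℂ) :
    ∑ T : Finset (Fin n), tensorOp (fun k => if k ∈ T then A else B) =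
      tensorOp fun _ => A + B := by
  ext a b
  simp only [tensorOp, of_apply, Matrix.sum_apply, Matrix.add_apply, Fintype.prod_add]
  refine Finset.sum_congr rfl fun T _ => ?_
  rw [← Finset.prod_mul_prod_compl T]
  congr 1
  · exact Finset.prod_congr rfl fun k hk => by rw [if_pos hk]
  · exact Finset.prod_congr rfl fun k hk => by rw [if_neg (Finset.mem_compl.1 hk)]

theorem tensorOp_posSemidef [Finite κ] {A : Fin n → Matrix κ κ ℂ}
    (hA : ∀ k, (A k).PosSemidef) : (tensorOp A).PosSemidef := by
  have := Fintype.ofFinite κ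
  choose B hB using fun k => exists_eq_conjTranspose_mul_self (hA k)
  rw [funext hB, ← tensorOp_mul, ← conjTranspose_tensorOp]
  exact posSemidef_conjTranspose_mul_self _

theorem tensorOp_mulVec_eq_zero [Fintype κ] {A : Fin n → Matrix κ κ ℂ} {k : Fin n} {u : κ → ℂ}
    (hu : A k *ᵥ u = 0) {φ : (Fin n → κ) → ℂ} (hφ : DependsOn φ {k}ᶜ) :
    (tensorOp A *ᵥ fun b => u (b k) * φ b) = 0 := by
  funext a
  let e := (Equiv.funSplitAt k κ).symm
  rw [mulVec, dotProduct, ← e.sum_comp, Fintype.sum_prod_type, Finset.sum_comm]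
  refine Finset.sum_eq_zero fun b _ => ?_
  have he (c : κ) (j : {j // j ≠ k}) : e (c, b) j = b j := by
    simp [e, Equiv.funSplitAt, Equiv.piSplitAt, j.2]
  have hek (c : κ) : e (c, b) k = c := by simp [e, Equiv.funSplitAt, Equiv.piSplitAt]
  have hsplit (c : κ) : tensorOp A a (e (c, b)) * (u (e (c, b) k) * φ (e (c, b))) =
      A k (a k) c * u c * ((∏ j : {j // j ≠ k}, A j (a j) (b j)) * φ (e (a k, b))) := by
    have hφe : φ (e (c, b)) = φ (e (a k, b)) := hφ fun j hj => by
      rw [he c ⟨j, hj⟩, he (a k) ⟨j, hj⟩]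
    rw [tensorOp, of_apply, Fintype.prod_eq_mul_prod_subtype_ne _ k, hek, hφe]
    simp only [he]
    ring
  have hrow : ∑ c, A k (a k) c * u c = 0 := congrFun hu (a k)
  rw [Finset.sum_congr rfl fun c _ => hsplit c, ← Finset.sum_mul, hrow, zero_mul]

end TensorOp

section DefectProj

variable {κ : Type*} {n : ℕ}

/-- The operator `|θ⟩⟨θ|`, the projection onto the line of `θ` when `θ` is a unit vector. -/
def rankOne (θ : EuclideanSpace ℂ κ) : Matrix κ κ ℂ := vecMulVec θ (star ⇑θ)

theorem isHermitian_rankOne (θ : EuclideanSpace ℂ κ) : (rankOne θ).IsHermitian := by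
  rw [IsHermitian, rankOne, conjTranspose_vecMulVec, star_star]

/-- The projection onto the vectors of `(ℂ^κ)^{⊗ n}` that equal `θ` on the factors outside `T` and
are orthogonal to `θ` on those in `T`, for a unit vector `θ`. -/
def defectProj [DecidableEq κ] (θ : EuclideanSpace ℂ κ) (T : Finset (Fin n)) :
    Matrix (Fin n → κ) (Fin n → κ) ℂ :=
  tensorOp fun k => if k ∈ T then 1 - rankOne θ else rankOne θ

theorem conjTranspose_defectProj [DecidableEq κ] (θ : EuclideanSpace ℂ κ) (T : Finset (Fin n)) :
    (defectProj θ T)ᴴ = defectProj θ T := by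
  rw [defectProj, conjTranspose_tensorOp]
  congr 1 with k : 1
  rw [apply_ite conjTranspose, conjTranspose_sub, conjTranspose_one, isHermitian_rankOne]

theorem sum_defectProj [DecidableEq κ] (θ : EuclideanSpace ℂ κ) :
    ∑ T : Finset (Fin n), defectProj θ T = 1 := by
  simp only [defectProj, sum_tensorOp_ite, sub_add_cancel, tensorOp_one]

variable [Fintype κ]

theorem trace_rankOne (θ : EuclideanSpace ℂ κ) : (rankOne θ).trace = ‖θ‖ ^ 2 := by
  rw [rankOne, trace_vecMulVec, ← EuclideanSpace.inner_eq_star_dotProduct,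
    inner_self_eq_norm_sq_to_K]
  rfl

theorem isDensity_rankOne {θ : EuclideanSpace ℂ κ} (hθ : ‖θ‖ = 1) : IsDensity (rankOne θ) :=
  ⟨posSemidef_vecMulVec_self_star _, by simp [trace_rankOne, hθ]⟩

theorem rankOne_mul_mul_rankOne (θ : EuclideanSpace ℂ κ) (A : Matrix κ κ ℂ) :
    rankOne θ * A * rankOne θ = (A * rankOne θ).trace • rankOne θ := by
  rw [rankOne, vecMulVec_mul, vecMulVec_mul_vecMulVec, mul_vecMulVec, trace_vecMulVec,
    dotProduct_comm (A *ᵥ _), dotProduct_mulVec, vecMulVec_smul]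

theorem isStarProjection_rankOne {θ : EuclideanSpace ℂ κ} (hθ : ‖θ‖ = 1) :
    IsStarProjection (rankOne θ) := by
  classical
  refine ⟨?_, isHermitian_rankOne θ⟩
  simpa [IsIdempotentElem, trace_rankOne, hθ] using rankOne_mul_mul_rankOne θ 1

variable [DecidableEq κ]

theorem isStarProjection_defectProj {θ : EuclideanSpace ℂ κ} (hθ : ‖θ‖ = 1) (T : Finset (Fin n)) :
    IsStarProjection (defectProj θ T) := by
  refine ⟨?_, conjTranspose_defectProj θ T⟩
  rw [IsIdempotentElem, defectProj, tensorOp_mul]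
  congr 1 with k : 1
  split_ifs
  · exact (isStarProjection_rankOne hθ).one_sub.1
  · exact (isStarProjection_rankOne hθ).1

theorem one_sub_rankOne_mulVec_self {θ : EuclideanSpace ℂ κ} (hθ : ‖θ‖ = 1) :
    (1 - rankOne θ) *ᵥ θ = 0 := by
  have hself : star ⇑θ ⬝ᵥ θ = 1 := by
    rw [dotProduct_comm, ← trace_vecMulVec]
    exact (isDensity_rankOne hθ).2
  rw [sub_mulVec, one_mulVec, rankOne, vecMulVec_mulVec, hself, MulOpposite.op_one, one_smul,
    sub_self]

end DefectProj

section DefectSupport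

variable {κ : Type*} {m n r : ℕ}

theorem exists_eq_mul_of_mem_defectVectors (h : m + r = n) {θ : EuclideanSpace ℂ κ}
    {ψ : EuclideanSpace ℂ (Fin n → κ)} (hψ : ψ ∈ defectVectors h θ) :
    ∃ U : Finset (Fin n), U.card = m ∧
      ∀ k ∈ U, ∃ φ, DependsOn φ {k}ᶜ ∧ ⇑ψ = fun b => θ (b k) * φ b := by
  obtain ⟨π, Ω, rfl⟩ := hψ
  let site : Fin m ↪ Fin n :=
    ((Fin.castAddEmb r).trans (finCongr h).toEmbedding).trans π.toEmbedding
  let rest (j : Fin r) : Fin n := π (Fin.cast h (Fin.natAdd m j))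
  have hrest (i : Fin m) (j : Fin r) : rest j ≠ site i := fun hij => by
    have : m + (j : ℕ) = i := by simpa using congrArg Fin.val (π.injective hij)
    lia
  refine ⟨Finset.univ.map site, by simp, fun k hk => ?_⟩
  obtain ⟨i, -, rfl⟩ := Finset.mem_map.1 hk
  refine ⟨fun b => (∏ j ∈ Finset.univ.erase i, θ (b (site j))) * Ω fun j => b (rest j),
    fun a b hab => ?_, funext fun b => ?_⟩
  · have hother : ∏ j ∈ Finset.univ.erase i, θ (a (site j)) =
        ∏ j ∈ Finset.univ.erase i, θ (b (site j)) := Finset.prod_congr rfl fun j hj => by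
      rw [hab _ (site.injective.ne (Finset.ne_of_mem_erase hj))]
    simp only [hother, hab _ (hrest i _)]
  · rw [← mul_assoc, Finset.mul_prod_erase _ (fun j => θ (b (site j))) (Finset.mem_univ i)]
    rfl

variable [Fintype κ]

theorem opSupport_eq_range [DecidableEq κ] {R : Matrix κ κ ℂ} (hR : R.IsHermitian) :
    opSupport R = LinearMap.range (toEuclideanLin R) := by
  rw [opSupport, LinearMap.orthogonal_ker, ← toEuclideanLin_conjTranspose_eq_adjoint, hR.eq]

theorem opSupport_le_ker_iff [DecidableEq κ] {Q R : Matrix κ κ ℂ} (hR : R.IsHermitian) :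
    opSupport R ≤ LinearMap.ker (toEuclideanLin Q) ↔ Q * R = 0 := by
  rw [opSupport_eq_range hR, LinearMap.range_le_ker_iff, ← toLpLin_mul_same]
  exact map_eq_zero_iff _ toEuclideanLin.injective

theorem defectProj_mulVec_eq_zero [DecidableEq κ] (h : m + r = n) {θ : EuclideanSpace ℂ κ}
    (hθ : ‖θ‖ = 1) {T : Finset (Fin n)} (hT : r < T.card) {ψ : EuclideanSpace ℂ (Fin n → κ)}
    (hψ : ψ ∈ defectVectors h θ) : defectProj θ T *ᵥ ψ = 0 := by
  obtain ⟨U, hU, hfactor⟩ := exists_eq_mul_of_mem_defectVectors h hψ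
  obtain ⟨k, hk⟩ : (T ∩ U).Nonempty := Finset.inter_nonempty_of_card_lt_card_add_card
    (Finset.subset_univ T) (Finset.subset_univ U) (by simp; lia)
  obtain ⟨hkT, hkU⟩ := Finset.mem_inter.1 hk
  obtain ⟨φ, hφ, hψφ⟩ := hfactor k hkU
  rw [hψφ, defectProj]
  refine tensorOp_mulVec_eq_zero ?_ hφ
  rw [if_pos hkT, one_sub_rankOne_mulVec_self hθ]

variable [DecidableEq κ]

theorem sum_defectProj_mul_eq_self (h : m + r = n) {θ : EuclideanSpace ℂ κ} (hθ : ‖θ‖ = 1)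
    {R : Matrix (Fin n → κ) (Fin n → κ) ℂ} (hR : R.IsHermitian)
    (hsupp : opSupport R ≤ Submodule.span ℂ (defectVectors h θ)) :
    (∑ T : Finset (Fin n) with T.card ≤ r, defectProj θ T) * R = R := by
  have hzero (T : Finset (Fin n)) (hT : r < T.card) : defectProj θ T * R = 0 := by
    refine (opSupport_le_ker_iff hR).1 (hsupp.trans (Submodule.span_le.2 fun ψ hψ => ?_))
    rw [SetLike.mem_coe, LinearMap.mem_ker, toLpLin_apply, defectProj_mulVec_eq_zero h hθ hT hψ,
      WithLp.toLp_zero]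
  rw [Finset.sum_mul, Finset.sum_filter_of_ne, ← Finset.sum_mul, sum_defectProj, Matrix.one_mul]
  intro T _ hne
  by_contra! hT
  exact hne (hzero T hT)

end DefectSupport

section PartialTrace

variable {ι κ X : Type*} {n : ℕ}

theorem tensorOp_kronecker (A : Fin n → Matrix ι ι ℂ) (B : Fin n → Matrix κ κ ℂ) :
    tensorOp (fun k => A k ⊗ₖ B k) = (tensorOp A ⊗ₖ tensorOp B).submatrix
      (Equiv.arrowProdEquivProdArrow _ _ _) (Equiv.arrowProdEquivProdArrow _ _ _) := by
  ext a b
  simp [tensorOp, Equiv.arrowProdEquivProdArrow, Finset.prod_mul_distrib]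

variable [Fintype κ]

/-- The partial trace of an operator on `ℂ^ι ⊗ ℂ^κ` over the factor `ℂ^κ`; `partialTrace` is its
version for `n` copies of the two factors. -/
def traceRight (R : Matrix (ι × κ) (ι × κ) ℂ) : Matrix ι ι ℂ :=
  of fun a b => ∑ e, R (a, e) (b, e)

theorem IsPurification.traceRight_rankOne {σ : Matrix ι ι ℂ}
    {θ : EuclideanSpace ℂ (ι × κ)} (h : IsPurification σ θ) :
    traceRight (rankOne θ) = σ := by
  ext a b
  exact h a b

variable [Fintype ι]

theorem trace_traceRight (R : Matrix (ι × κ) (ι × κ) ℂ) : (traceRight R).trace = R.trace := by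
  simp only [trace, diag, traceRight, of_apply, Fintype.sum_prod_type]

theorem trace_mul_traceRight [DecidableEq κ] (A : Matrix ι ι ℂ) (R : Matrix (ι × κ) (ι × κ) ℂ) :
    (A * traceRight R).trace = ((A ⊗ₖ (1 : Matrix κ κ ℂ)) * R).trace := by
  simp only [trace, diag, mul_apply, traceRight, of_apply, kroneckerMap_apply, one_apply,
    Fintype.sum_prod_type, mul_ite, mul_one, mul_zero, ite_mul, zero_mul, Finset.sum_ite_eq,
    Finset.mem_univ, if_true, Finset.mul_sum]
  exact Finset.sum_congr rfl fun a _ => Finset.sum_comm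

theorem trace_tensorOp_mul_partialTrace [DecidableEq κ] (A : Fin n → Matrix ι ι ℂ)
    (R : Matrix (Fin n → ι × κ) (Fin n → ι × κ) ℂ) :
    (tensorOp A * partialTrace R).trace =
      (tensorOp (fun k => A k ⊗ₖ (1 : Matrix κ κ ℂ)) * R).trace := by
  let e := Equiv.arrowProdEquivProdArrow (Fin n) (fun _ => ι) fun _ => κ
  have hpartial : partialTrace R = traceRight (R.submatrix e.symm e.symm) := rfl
  have hR : R = (R.submatrix e.symm e.symm).submatrix e e := by simp
  rw [hpartial, trace_mul_traceRight, tensorOp_kronecker, tensorOp_one]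
  conv_rhs => rw [hR, submatrix_mul_equiv]
  exact (e.sum_comp _).symm

variable {σ : Matrix ι ι ℂ} {θ : EuclideanSpace ℂ (ι × κ)}

theorem IsPurification.norm_eq_one (h : IsPurification σ θ) (hσ : σ.trace = 1) : ‖θ‖ = 1 := by
  rw [← h.traceRight_rankOne, trace_traceRight, trace_rankOne] at hσ
  exact (pow_eq_one_iff_of_nonneg (norm_nonneg θ) two_ne_zero).1 (by exact_mod_cast hσ)

theorem IsPurification.outcomeProb_kronecker_one [DecidableEq κ] (h : IsPurification σ θ)
    (M : X → Matrix ι ι ℂ) :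
    outcomeProb (fun y => M y ⊗ₖ (1 : Matrix κ κ ℂ)) (rankOne θ) = outcomeProb M σ := by
  funext y
  rw [outcomeProb, outcomeProb, ← trace_mul_traceRight, h.traceRight_rankOne]

theorem outcomeProb_partialTrace [DecidableEq κ] (M : X → Matrix ι ι ℂ)
    (R : Matrix (Fin n → ι × κ) (Fin n → ι × κ) ℂ) :
    outcomeProb (productPOVM M n) (partialTrace R) =
      outcomeProb (productPOVM (fun y => M y ⊗ₖ (1 : Matrix κ κ ℂ)) n) R := by
  funext x
  simp only [outcomeProb, productPOVM, trace_tensorOp_mul_partialTrace]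

end PartialTrace

section Measurement

variable {ι X : Type*} [DecidableEq ι] [Fintype X] {M : X → Matrix ι ι ℂ} {n : ℕ}

theorem IsPOVM.kronecker_one [Finite ι] (hM : IsPOVM M) (κ : Type*) [Finite κ] [DecidableEq κ] :
    IsPOVM fun y => M y ⊗ₖ (1 : Matrix κ κ ℂ) := by
  refine ⟨fun y => (hM.1 y).kronecker PosSemidef.one, ?_⟩
  rw [← one_kronecker_one, ← hM.2]
  ext a b
  simp [Matrix.sum_apply, Finset.sum_mul]

theorem isPOVM_productPOVM [Finite ι] (hM : IsPOVM M) (n : ℕ) : IsPOVM (productPOVM M n) := by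
  refine ⟨fun x => tensorOp_posSemidef fun k => hM.1 (x k), ?_⟩
  rw [← tensorOp_one, ← hM.2]
  exact sum_tensorOp fun _ => M

variable [Fintype ι]

theorem IsPOVM.outcomeProb_nonneg (hM : IsPOVM M) {σ : Matrix ι ι ℂ} (hσ : σ.PosSemidef) (y : X) :
    0 ≤ outcomeProb M σ y :=
  (Complex.nonneg_iff.1 (trace_mul_nonneg (hM.1 y) hσ)).1

theorem IsPOVM.ofReal_outcomeProb (hM : IsPOVM M) {σ : Matrix ι ι ℂ} (hσ : σ.PosSemidef)
    (y : X) : (outcomeProb M σ y : ℂ) = (M y * σ).trace :=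
  Complex.ext rfl (Complex.nonneg_iff.1 (trace_mul_nonneg (hM.1 y) hσ)).2

theorem IsPOVM.sum_outcomeProb (hM : IsPOVM M) (σ : Matrix ι ι ℂ) :
    ∑ y, outcomeProb M σ y = σ.trace.re := by
  simp only [outcomeProb]
  rw [← Complex.re_sum, ← trace_sum, ← Finset.sum_mul, hM.2, Matrix.one_mul]

theorem IsPOVM.outcomeProb_mem_stdSimplex (hM : IsPOVM M) {σ : Matrix ι ι ℂ} (hσ : IsDensity σ) :
    outcomeProb M σ ∈ stdSimplex ℝ X :=
  ⟨hM.outcomeProb_nonneg hσ.1, by rw [hM.sum_outcomeProb, hσ.2, Complex.one_re]⟩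

theorem IsPOVM.eventProb_le_one (hM : IsPOVM M) {σ : Matrix ι ι ℂ} (hσ : IsDensity σ)
    (W : Set X) : eventProb M σ W ≤ 1 := by
  obtain ⟨hnonneg, hsum⟩ := hM.outcomeProb_mem_stdSimplex hσ
  rw [← hsum]
  exact Finset.sum_le_sum fun y _ => Set.indicator_le_self' (fun y _ => hnonneg y) y

theorem IsPOVM.eventProb_mono (hM : IsPOVM M) {σ : Matrix ι ι ℂ} (hσ : σ.PosSemidef)
    {V W : Set X} (hVW : V ⊆ W) : eventProb M σ V ≤ eventProb M σ W :=
  Finset.sum_le_sum fun y _ =>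
    Set.indicator_le_indicator_of_subset hVW (hM.outcomeProb_nonneg hσ) y

theorem IsPOVM.outcomeProb_le_card_mul_sum (hM : IsPOVM M) {R : Matrix ι ι ℂ} (hR : R.PosSemidef)
    {τ : Type*} {s : Finset τ} {B : τ → Matrix ι ι ℂ} (hB : (∑ t ∈ s, B t)ᴴ * R * ∑ t ∈ s, B t = R)
    (y : X) : outcomeProb M R y ≤ s.card * ∑ t ∈ s, outcomeProb M ((B t)ᴴ * R * B t) y := by
  have h := hM.outcomeProb_nonneg (posSemidef_pinching hR s B) y
  rw [hB, outcomeProb, Matrix.mul_sub, Matrix.mul_smul, Finset.mul_sum, trace_sub, trace_smul,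
    trace_sum, Complex.sub_re, Complex.smul_re, Complex.re_sum, smul_eq_mul] at h
  exact sub_nonneg.1 h

variable {θ : EuclideanSpace ℂ ι}

theorem defectProj_mul_tensorOp_mul_defectProj (hθ : ‖θ‖ = 1) {T : Finset (Fin n)}
    {A : Fin n → Matrix ι ι ℂ} (hA : ∀ k ∈ T, A k = 1) :
    defectProj θ T * tensorOp A * defectProj θ T =
      (∏ k ∈ Tᶜ, (A k * rankOne θ).trace) • defectProj θ T := by
  rw [defectProj, tensorOp_mul, tensorOp_mul, ← Fintype.prod_ite_mem, ← tensorOp_smul]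
  congr 1 with k : 1
  by_cases hk : k ∈ T
  · simp only [hk, hA k hk, Finset.mem_compl, not_true_eq_false, if_true, if_false, one_smul,
      Matrix.mul_one]
    exact (isStarProjection_rankOne hθ).one_sub.1
  · simp only [hk, Finset.mem_compl, not_false_eq_true, if_true, if_false,
      rankOne_mul_mul_rankOne]

theorem trace_defectProj_mul_mul (hθ : ‖θ‖ = 1) (T : Finset (Fin n))
    (R : Matrix (Fin n → ι) (Fin n → ι) ℂ) :
    (defectProj θ T * R * defectProj θ T).trace = (defectProj θ T * R).trace := by
  rw [trace_mul_comm, ← Matrix.mul_assoc, (isStarProjection_defectProj hθ T).1]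

theorem IsPOVM.isIIDOn_defectProj (hM : IsPOVM M) (hθ : ‖θ‖ = 1) (T : Finset (Fin n))
    (R : Matrix (Fin n → ι) (Fin n → ι) ℂ) :
    IsIIDOn (outcomeProb M (rankOne θ)) Tᶜ
      (outcomeProb (productPOVM M n) (defectProj θ T * R * defectProj θ T)) := by
  intro w
  set Q := defectProj θ T
  let A (k : Fin n) : Matrix ι ι ℂ := ∑ y, (if k ∈ Tᶜ then (w k y : ℂ) else 1) • M y
  have hA : tensorOp A =
      ∑ x, ((∏ k ∈ Tᶜ, w k (x k) : ℝ) : ℂ) • productPOVM M n x := by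
    rw [← sum_tensorOp fun k y => (if k ∈ Tᶜ then (w k y : ℂ) else 1) • M y]
    simp only [tensorOp_smul, Fintype.prod_ite_mem, Complex.ofReal_prod, productPOVM]
  have hA1 (k : Fin n) (hk : k ∈ T) : A k = 1 := by simp [A, hk, hM.2]
  have hmean (k : Fin n) (hk : k ∈ Tᶜ) :
      (A k * rankOne θ).trace = (∑ y, outcomeProb M (rankOne θ) y * w k y : ℝ) := by
    simp only [A, if_pos hk, Finset.sum_mul, trace_sum, smul_mul, trace_smul, smul_eq_mul,
      Complex.ofReal_sum, Complex.ofReal_mul, hM.ofReal_outcomeProb (isDensity_rankOne hθ).1,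
      mul_comm]
  have hfactor : Q * tensorOp A * Q =
      ((∏ k ∈ Tᶜ, ∑ y, outcomeProb M (rankOne θ) y * w k y : ℝ) : ℂ) • Q := by
    rw [defectProj_mul_tensorOp_mul_defectProj hθ hA1, Finset.prod_congr rfl hmean,
      Complex.ofReal_prod]
  have htrace : ∑ x, outcomeProb (productPOVM M n) (Q * R * Q) x *
      ∏ k ∈ Tᶜ, w k (x k) = (Q * tensorOp A * Q * R).trace.re := by
    have hcycle : (Q * tensorOp A * Q * R).trace = (tensorOp A * (Q * R * Q)).trace := by
      rw [← Matrix.mul_assoc, trace_mul_comm _ Q]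
      simp only [Matrix.mul_assoc]
    rw [hcycle, hA, Finset.sum_mul, trace_sum, Complex.re_sum]
    refine Finset.sum_congr rfl fun x _ => ?_
    rw [smul_mul, trace_smul, smul_eq_mul, Complex.re_ofReal_mul, mul_comm, outcomeProb]
  rw [htrace, hfactor, (isPOVM_productPOVM hM n).sum_outcomeProb, trace_defectProj_mul_mul hθ,
    smul_mul, trace_smul, smul_eq_mul, Complex.re_ofReal_mul, mul_comm]

end Measurement

section TailBound

variable {κ X : Type*} [Fintype κ] [DecidableEq κ] [Fintype X]
  {N : X → Matrix κ κ ℂ} {m n r : ℕ} {θ : EuclideanSpace ℂ κ} {R : Matrix (Fin n → κ) (Fin n → κ) ℂ}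

theorem sum_trace_defectProj_mul_mul (h : m + r = n) (hθ : ‖θ‖ = 1) (hR : R.IsHermitian)
    (hsupp : opSupport R ≤ Submodule.span ℂ (defectVectors h θ)) :
    ∑ T : Finset (Fin n) with T.card ≤ r, (defectProj θ T * R * defectProj θ T).trace =
      R.trace := by
  simp only [trace_defectProj_mul_mul hθ]
  rw [← trace_sum, ← Finset.sum_mul, sum_defectProj_mul_eq_self h hθ hR hsupp]

theorem IsPOVM.outcomeProb_productPOVM_le (hN : IsPOVM N) (h : m + r = n) (hθ : ‖θ‖ = 1)
    (hR : R.PosSemidef) (hsupp : opSupport R ≤ Submodule.span ℂ (defectVectors h θ))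
    (x : Fin n → X) :
    outcomeProb (productPOVM N n) R x ≤
      (Finset.univ.filter fun T : Finset (Fin n) => T.card ≤ r).card *
        ∑ T : Finset (Fin n) with T.card ≤ r,
          outcomeProb (productPOVM N n) (defectProj θ T * R * defectProj θ T) x := by
  have hfix := sum_defectProj_mul_eq_self h hθ hR.1 hsupp
  have hconj : (∑ T : Finset (Fin n) with T.card ≤ r, defectProj θ T)ᴴ =
      ∑ T : Finset (Fin n) with T.card ≤ r, defectProj θ T := by
    simp only [conjTranspose_sum, conjTranspose_defectProj]
  have hfix' : R * ∑ T : Finset (Fin n) with T.card ≤ r, defectProj θ T = R := by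
    simpa only [conjTranspose_mul, hconj, hR.1.eq] using congrArg conjTranspose hfix
  have hpinch := (isPOVM_productPOVM hN n).outcomeProb_le_card_mul_sum hR
    (B := defectProj (n := n) θ) (by rw [hconj, hfix, hfix']) x
  simpa only [conjTranspose_defectProj] using hpinch

variable [DecidableEq X]

theorem IsPOVM.sum_indicator_defectProj_le (hN : IsPOVM N) (hn : 0 < n) (hθ : ‖θ‖ = 1)
    (hR : R.PosSemidef) {T : Finset (Fin n)} (hT : T.card ≤ r) {δ : ℝ} (hδ : 0 ≤ δ) :
    ∑ x, {x | δ + 2 * r / n < l1Dist (freq x) (outcomeProb N (rankOne θ))}.indicator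
        (outcomeProb (productPOVM N n) (defectProj θ T * R * defectProj θ T)) x ≤
      2 ^ Fintype.card X * Real.exp (-(n * δ ^ 2 / 2)) *
        (defectProj θ T * R * defectProj θ T).trace.re := by
  have hpos : (defectProj θ T * R * defectProj θ T).PosSemidef := by
    simpa only [conjTranspose_defectProj] using hR.conjTranspose_mul_mul_same (defectProj θ T)
  have hq0 := (isPOVM_productPOVM hN n).outcomeProb_nonneg hpos
  have htail := (hN.isIIDOn_defectProj hθ T R).sum_indicator_l1Dist_freq_le hn
    (hN.outcomeProb_mem_stdSimplex (isDensity_rankOne hθ)) hq0 hδ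
  rw [compl_compl, (isPOVM_productPOVM hN n).sum_outcomeProb] at htail
  refine le_trans (Finset.sum_le_sum fun x _ => ?_) htail
  refine Set.indicator_le_indicator_of_subset (fun x hx => ?_) hq0 x
  refine lt_of_le_of_lt ?_ (Set.mem_ofPred.1 hx)
  gcongr

theorem IsPOVM.eventProb_l1Dist_le (hN : IsPOVM N) (h : m + r = n) (hn : 0 < n) (hθ : ‖θ‖ = 1)
    (hR : IsDensity R) (hsupp : opSupport R ≤ Submodule.span ℂ (defectVectors h θ)) {δ : ℝ}
    (hδ : 0 ≤ δ) :
    eventProb (productPOVM N n) R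
        {x | δ + 2 * r / n < l1Dist (freq x) (outcomeProb N (rankOne θ))} ≤
      (Finset.univ.filter fun T : Finset (Fin n) => T.card ≤ r).card *
        (2 ^ Fintype.card X * Real.exp (-(n * δ ^ 2 / 2))) := by
  set S := Finset.univ.filter fun T : Finset (Fin n) => T.card ≤ r
  set W := {x : Fin n → X | δ + 2 * r / n < l1Dist (freq x) (outcomeProb N (rankOne θ))}
  set q := fun T : Finset (Fin n) =>
    outcomeProb (productPOVM N n) (defectProj θ T * R * defectProj θ T)
  have hpinch (x : Fin n → X) : W.indicator (outcomeProb (productPOVM N n) R) x ≤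
      S.card * ∑ T ∈ S, W.indicator (q T) x := by
    by_cases hx : x ∈ W
    · simpa only [Set.indicator_of_mem hx] using
        hN.outcomeProb_productPOVM_le h hθ hR.1 hsupp x
    · simp only [Set.indicator_of_notMem hx, Finset.sum_const_zero, mul_zero, le_refl]
  calc eventProb (productPOVM N n) R W
      ≤ ∑ x, S.card * ∑ T ∈ S, W.indicator (q T) x := Finset.sum_le_sum fun x _ => hpinch x
    _ = S.card * ∑ T ∈ S, ∑ x, W.indicator (q T) x := by
        rw [← Finset.mul_sum, Finset.sum_comm]
    _ ≤ S.card * ∑ T ∈ S, 2 ^ Fintype.card X * Real.exp (-(n * δ ^ 2 / 2)) *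
          (defectProj θ T * R * defectProj θ T).trace.re := by
        gcongr with T hT
        exact hN.sum_indicator_defectProj_le hn hθ hR.1 (Finset.mem_filter.1 hT).2 hδ
    _ = _ := by
        rw [← Finset.mul_sum, ← Complex.re_sum, sum_trace_defectProj_mul_mul h hθ hR.1.1 hsupp,
          hR.2, Complex.one_re, mul_one]

end TailBound

section Entropy

theorem binEntropyBits_eq (p : ℝ) : binEntropyBits p = Real.binEntropy p / Real.log 2 := by
  simp only [binEntropyBits, Real.logb, Real.binEntropy, Real.log_inv]
  ring

theorem one_sub_le_binEntropyBits {p : ℝ} (hp : 1 / 2 ≤ p) (hp1 : p ≤ 1) :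
    1 - p ≤ binEntropyBits p := by
  have hfst : 0 ≤ -p * Real.logb 2 p :=
    mul_nonneg_of_nonpos_of_nonpos (by linarith) (Real.logb_nonpos one_lt_two (by linarith) hp1)
  have hsnd : 1 - p ≤ -((1 - p) * Real.logb 2 (1 - p)) := by
    rcases hp1.eq_or_lt with rfl | hlt
    · simp
    · have hlog : Real.logb 2 (1 - p) ≤ -1 := by
        rw [Real.logb_le_iff_le_rpow one_lt_two (by linarith), Real.rpow_neg_one]
        linarith
      nlinarith
  rw [binEntropyBits]
  linarith

theorem exp_neg_mul_binEntropy_div {m n r : ℕ} (h : m + r = n) (hn : 0 < n) :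
    Real.exp (-(n * Real.binEntropy (r / n))) = (r / n : ℝ) ^ r * (m / n : ℝ) ^ m := by
  have hn' : (0 : ℝ) < n := by exact_mod_cast hn
  have hpow (k : ℕ) : Real.exp (k * Real.log (k / n)) = (k / n : ℝ) ^ k := by
    rcases k.eq_zero_or_pos with rfl | hk
    · simp
    · rw [Real.exp_nat_mul, Real.exp_log (by positivity)]
  have hm : (1 : ℝ) - r / n = m / n := by
    rw [← h]
    push_cast
    rw [← h] at hn'
    push_cast at hn'
    field_simp
    ring
  rw [← hpow, ← hpow, ← Real.exp_add, Real.binEntropy, Real.log_inv, Real.log_inv, hm]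
  congr 1
  field_simp
  ring

theorem pow_mul_pow_sub_le {p q : ℝ} (hp : 0 ≤ p) (hpq : p ≤ q) {t r n : ℕ} (htr : t ≤ r)
    (hrn : r ≤ n) : p ^ r * q ^ (n - r) ≤ p ^ t * q ^ (n - t) := by
  have hq : 0 ≤ q := hp.trans hpq
  calc p ^ r * q ^ (n - r) = p ^ t * p ^ (r - t) * q ^ (n - r) := by
        rw [← pow_add, Nat.add_sub_cancel' htr]
    _ ≤ p ^ t * q ^ (r - t) * q ^ (n - r) := by gcongr
    _ = p ^ t * q ^ (n - t) := by
        rw [mul_assoc, ← pow_add, add_comm, Nat.sub_add_sub_cancel hrn htr]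

theorem card_filter_card_le_le_exp_binEntropy {α : Type*} [Fintype α] {m r : ℕ}
    (h : m + r = Fintype.card α) (hα : 0 < Fintype.card α) (hrm : r ≤ m) :
    ((Finset.univ.filter fun T : Finset α => T.card ≤ r).card : ℝ) ≤
      Real.exp (Fintype.card α * Real.binEntropy (r / Fintype.card α)) := by
  set n := Fintype.card α
  set p : ℝ := r / n
  set q : ℝ := m / n
  have hpq : p ≤ q := div_le_div_of_nonneg_right (by exact_mod_cast hrm) n.cast_nonneg
  have hsum : ∑ T : Finset α, p ^ T.card * q ^ (n - T.card) = 1 := by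
    rw [Fintype.sum_pow_mul_eq_add_pow, ← add_div, add_comm, ← Nat.cast_add, h,
      div_self (by exact_mod_cast hα.ne'), one_pow]
  rw [← div_le_one (Real.exp_pos _), div_eq_mul_inv, ← Real.exp_neg,
    exp_neg_mul_binEntropy_div h hα, ← nsmul_eq_mul, ← Finset.sum_const, ← hsum]
  calc _ ≤ ∑ T : Finset α with T.card ≤ r, p ^ T.card * q ^ (n - T.card) := by
        refine Finset.sum_le_sum fun T hT => ?_
        have hm : n - r = m := Nat.sub_eq_of_eq_add h.symm
        simpa only [hm] using pow_mul_pow_sub_le (n := n) (by positivity) hpq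
          (Finset.mem_filter.1 hT).2 (h ▸ r.le_add_left m)
    _ ≤ _ := Finset.sum_le_sum_of_subset_of_nonneg (Finset.filter_subset _ _) fun T _ _ => by
        positivity

end Entropy

section Deviation

variable {n r : ℕ} {ε : ℝ}

/-- The quantity under the square root in `deviation`, without its dimension term. -/
noncomputable def radicand (c : ℕ) (ε : ℝ) (r n : ℕ) : ℝ :=
  Real.logb 2 (1 / ε) / n + (c : ℝ) / n * Real.logb 2 ((n : ℝ) / 2 + 1) + binEntropyBits (r / n)

theorem deviation_eq (c d : ℕ) (ε : ℝ) (r n : ℕ) :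
    deviation c d ε r n = 2 * √(radicand c ε r n + 2 * r / n * Real.logb 2 d) + 2 * r / n := rfl

theorem deviation_one (c : ℕ) (ε : ℝ) (r n : ℕ) :
    deviation c 1 ε r n = 2 * √(radicand c ε r n) + 2 * r / n := by
  rw [deviation_eq, Nat.cast_one, Real.logb_one, mul_zero, add_zero]

theorem deviation_one_le (c d : ℕ) (ε : ℝ) (r n : ℕ) :
    deviation c 1 ε r n ≤ deviation c d ε r n := by
  have hlogd : 0 ≤ Real.logb 2 d :=
    div_nonneg (Real.log_natCast_nonneg d) (Real.log_nonneg one_le_two)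
  rw [deviation_one, deviation_eq]
  gcongr
  exact le_add_of_nonneg_right (by positivity)

theorem binEntropyBits_le_radicand (c : ℕ) (hε : 0 < ε) (hε1 : ε ≤ 1) :
    binEntropyBits (r / n) ≤ radicand c ε r n := by
  have hlogε : 0 ≤ Real.logb 2 (1 / ε) :=
    Real.logb_nonneg one_lt_two ((one_le_div hε).2 hε1)
  have hlogn : 0 ≤ Real.logb 2 ((n : ℝ) / 2 + 1) :=
    Real.logb_nonneg one_lt_two (le_add_of_nonneg_left (by positivity))
  exact le_add_of_nonneg_left (by positivity)

theorem two_le_deviation_one (c : ℕ) (hn : 0 < n) (hr : (n : ℝ) / 2 ≤ r) (hrn : r ≤ n)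
    (hε : 0 < ε) (hε1 : ε ≤ 1) : 2 ≤ deviation c 1 ε r n := by
  have hn' : (0 : ℝ) < n := by exact_mod_cast hn
  set p : ℝ := r / n with hp
  have hp2 : 1 / 2 ≤ p := by rw [hp, le_div_iff₀ hn']; linarith
  have hp1 : p ≤ 1 := (div_le_one hn').2 (by exact_mod_cast hrn)
  have hroot : 1 - p ≤ √(radicand c ε r n) := by
    refine Real.le_sqrt_of_sq_le ?_
    have := (one_sub_le_binEntropyBits hp2 hp1).trans (binEntropyBits_le_radicand c hε hε1)
    nlinarith
  rw [deviation_one, mul_div_assoc]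
  linarith

theorem log_two_mul_radicand (c : ℕ) (ε : ℝ) (r : ℕ) (hn : 0 < n) :
    Real.log 2 * (n * radicand c ε r n) =
      n * Real.binEntropy (r / n) + c * Real.log ((n : ℝ) / 2 + 1) - Real.log ε := by
  have : (n : ℝ) ≠ 0 := by exact_mod_cast hn.ne'
  have : Real.log 2 ≠ 0 := (Real.log_pos one_lt_two).ne'
  rw [radicand, binEntropyBits_eq]
  simp only [Real.logb, one_div, Real.log_inv]
  field_simp
  ring

theorem log_two_le_two_mul_log (hn : 0 < n) : Real.log 2 ≤ 2 * Real.log ((n : ℝ) / 2 + 1) := by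
  have hn1 : (1 : ℝ) ≤ n := by exact_mod_cast hn
  rw [← Nat.cast_two (R := ℝ), ← Real.log_pow]
  refine Real.log_le_log (by norm_num) ?_
  push_cast
  nlinarith

theorem card_mul_two_pow_mul_exp_le {m : ℕ} (c : ℕ) (h : m + r = n) (hn : 0 < n) (hrm : r ≤ m)
    (hε : 0 < ε) (hε1 : ε ≤ 1) :
    (Finset.univ.filter fun T : Finset (Fin n) => T.card ≤ r).card *
      (2 ^ c * Real.exp (-(n * (2 * √(radicand c ε r n)) ^ 2 / 2))) ≤ ε := by
  have hball := card_filter_card_le_le_exp_binEntropy (α := Fin n) (by simpa using h)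
    (by simpa using hn) hrm
  rw [Fintype.card_fin] at hball
  have hentropy : 0 ≤ Real.binEntropy (r / n) := Real.binEntropy_nonneg (by positivity)
    (div_le_one_of_le₀ (by exact_mod_cast (by lia : r ≤ n)) n.cast_nonneg)
  set A := radicand c ε r n
  have hA : 0 ≤ A := le_trans (by rw [binEntropyBits_eq]; positivity)
    (binEntropyBits_le_radicand c hε hε1)
  have hnats : n * Real.binEntropy (r / n) + c * Real.log ((n : ℝ) / 2 + 1) - Real.log ε ≤
      n * A := by
    have hscale : Real.log 2 * (n * A) ≤ n * A :=
      mul_le_of_le_one_left (by positivity) (by linarith [Real.log_two_lt_d9])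
    linarith [log_two_mul_radicand c ε r hn]
  have hlogε : Real.log ε ≤ 0 := Real.log_nonpos hε.le hε1
  have hunion : c * Real.log 2 ≤ c * (2 * Real.log ((n : ℝ) / 2 + 1)) := by
    gcongr
    exact log_two_le_two_mul_log hn
  calc _ ≤ Real.exp (n * Real.binEntropy (r / n)) *
        (Real.exp (c * Real.log 2) * Real.exp (-(n * (2 * √A) ^ 2 / 2))) := by
        rw [Real.exp_nat_mul (Real.log 2), Real.exp_log two_pos]
        gcongr
    _ ≤ Real.exp (Real.log ε) := by
        rw [← Real.exp_add, ← Real.exp_add, Real.exp_le_exp, mul_pow, Real.sq_sqrt hA]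
        linarith [mul_nonneg n.cast_nonneg hentropy]
    _ = ε := Real.exp_log hε

theorem tendsto_log_div_two_add_one_div :
    Tendsto (fun n : ℕ => Real.log ((n : ℝ) / 2 + 1) / n) atTop (𝓝 0) := by
  have harg : Tendsto (fun n : ℕ => (n : ℝ) / 2 + 1) atTop atTop :=
    tendsto_atTop_add_const_right _ _ (tendsto_natCast_atTop_atTop.atTop_div_const two_pos)
  have hbound : (fun n : ℕ => (n : ℝ) / 2 + 1) =O[atTop] fun n : ℕ => (n : ℝ) := by
    refine IsBigO.of_bound 2 ?_
    filter_upwards [eventually_ge_atTop 1] with n hn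
    have : (1 : ℝ) ≤ n := by exact_mod_cast hn
    rw [Real.norm_of_nonneg (by positivity), Real.norm_of_nonneg (by positivity)]
    linarith
  exact ((Real.isLittleO_log_id_atTop.comp_tendsto harg).trans_isBigO hbound).tendsto_div_nhds_zero

theorem tendsto_radicand (c : ℕ) (ε : ℝ) {r : ℕ → ℕ}
    (hr : Tendsto (fun n => (r n : ℝ) / n) atTop (𝓝 0)) :
    Tendsto (fun n => radicand c ε (r n) n) atTop (𝓝 0) := by
  have hentropy : Tendsto (fun n => binEntropyBits ((r n : ℝ) / n)) atTop (𝓝 0) := by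
    have := ((Real.binEntropy_continuous.tendsto 0).comp hr).div_const (Real.log 2)
    simpa only [Real.binEntropy_zero, zero_div, Function.comp_def, ← binEntropyBits_eq] using this
  have hsum := ((tendsto_const_div_atTop_nhds_zero_nat (Real.logb 2 (1 / ε))).add
    (tendsto_log_div_two_add_one_div.const_mul (c / Real.log 2))).add hentropy
  simp only [mul_zero, add_zero] at hsum
  refine hsum.congr fun n => ?_
  simp only [radicand, Real.logb]
  ring

theorem tendsto_deviation (c d : ℕ) (ε : ℝ) {r : ℕ → ℕ}
    (hr : (fun n => (r n : ℝ)) =o[atTop] (fun n : ℕ => (n : ℝ))) :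
    Tendsto (fun n => deviation c d ε (r n) n) atTop (𝓝 0) := by
  have hdiv := hr.tendsto_div_nhds_zero
  have hdefects := hdiv.const_mul 2
  have hsum := (((tendsto_radicand c ε hdiv).add
    (hdefects.mul_const (Real.logb 2 d))).sqrt.const_mul 2).add hdefects
  simpa only [deviation_eq, mul_div_assoc, Real.sqrt_zero, mul_zero, zero_mul, add_zero] using hsum

end Deviation

section DeviationBound

variable {X : Type*} [Fintype X] [DecidableEq X] {m n r : ℕ}

theorem IsPOVM.eventProb_deviation_one_le {κ : Type*} [Fintype κ] [DecidableEq κ]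
    {N : X → Matrix κ κ ℂ} {θ : EuclideanSpace ℂ κ} {R : Matrix (Fin n → κ) (Fin n → κ) ℂ}
    (hN : IsPOVM N) (h : m + r = n) (hn : 0 < n) (hθ : ‖θ‖ = 1) (hR : IsDensity R)
    (hsupp : opSupport R ≤ Submodule.span ℂ (defectVectors h θ)) {ε : ℝ} (hε : 0 < ε) :
    eventProb (productPOVM N n) R
      {x | deviation (Fintype.card X) 1 ε r n < l1Dist (freq x) (outcomeProb N (rankOne θ))} ≤
        ε := by
  rcases le_total 1 ε with hε1 | hε1
  · exact ((isPOVM_productPOVM hN n).eventProb_le_one hR _).trans hε1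
  rcases le_or_gt r m with hrm | hmr
  · rw [deviation_one]
    exact (hN.eventProb_l1Dist_le h hn hθ hR hsupp (by positivity)).trans
      (card_mul_two_pow_mul_exp_le _ h hn hrm hε hε1)
  · -- More than half of the sites may be defective: the bound exceeds the diameter of the simplex.
    have hr : (n : ℝ) / 2 ≤ r := by
      rw [div_le_iff₀ two_pos]
      exact_mod_cast (by lia : n ≤ r * 2)
    have hempty : {x : Fin n → X | deviation (Fintype.card X) 1 ε r n <
        l1Dist (freq x) (outcomeProb N (rankOne θ))} = ∅ :=
      Set.eq_empty_of_forall_notMem fun x hx => (Set.mem_ofPred.1 hx).not_ge <|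
        (l1Dist_le_two (freq_mem_stdSimplex hn x)
          (hN.outcomeProb_mem_stdSimplex (isDensity_rankOne hθ))).trans
          (two_le_deviation_one _ hn hr (by lia) hε hε1)
    rw [hempty]
    simpa only [eventProb, Set.indicator_empty, Finset.sum_const_zero] using hε.le

end DeviationBound

end AlmostIID

-- At dimension argument `1` the term `2 r / n * log d` of `deviation` vanishes.
theorem mainTheorem5_general {ι X : Type*} [Fintype ι] [DecidableEq ι] [Fintype X] [DecidableEq X]
    (M : X → Matrix ι ι ℂ) (hM : IsPOVM M) :
    (∀ {κ : Type*} [Fintype κ] [DecidableEq κ] {m n r : ℕ} (h : m + r = n), 0 < n →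
      ∀ (σ : Matrix ι ι ℂ) (θ : EuclideanSpace ℂ (ι × κ))
        (R : Matrix (Fin n → ι × κ) (Fin n → ι × κ) ℂ), σ.trace = 1 → IsPurification σ θ →
      IsDensity R → opSupport R ≤ Submodule.span ℂ (defectVectors h θ) →
      ∀ ε : ℝ, 0 < ε →
        eventProb (productPOVM M n) (partialTrace R)
          {x | deviation (Fintype.card X) 1 ε r n < l1Dist (freq x) (outcomeProb M σ)} ≤ ε) ∧
    (∀ (d : ℕ) (ε : ℝ), 0 < ε → ∀ r : ℕ → ℕ,
      (fun n => (r n : ℝ)) =o[atTop] (fun n : ℕ => (n : ℝ)) →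
      Tendsto (fun n => deviation (Fintype.card X) d ε (r n) n) atTop (𝓝 0)) := by
  refine ⟨fun {κ} _ _ {m n r} h hn σ θ R hσ hθ hR hsupp ε hε => ?_,
    fun d ε _ r hr => tendsto_deviation _ d ε hr⟩
  rw [eventProb, outcomeProb_partialTrace, ← hθ.outcomeProb_kronecker_one M]
  exact (hM.kronecker_one κ).eventProb_deviation_one_le h hn (hθ.norm_eq_one hσ) hR hsupp hε

theorem mainTheorem5 {ι X : Type*} [Fintype ι] [DecidableEq ι] [Fintype X] [DecidableEq X]
    (M : X → Matrix ι ι ℂ) (hM : IsPOVM M) :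
    (∀ (n r : ℕ), 0 < n → (r : ℝ) ≤ (n : ℝ) / 2 →
      ∀ (σ : Matrix ι ι ℂ) (ρ : Matrix (Fin n → ι) (Fin n → ι) ℂ), IsAlmostIID n r σ ρ →
      ∀ ε : ℝ, 0 < ε →
        eventProb (productPOVM M n) ρ
          {x | deviation (Fintype.card X) (Fintype.card ι) ε r n
            < l1Dist (freq x) (outcomeProb M σ)} ≤ ε) ∧
    (∀ ε : ℝ, 0 < ε → ∀ r : ℕ → ℕ,
      (fun n => (r n : ℝ)) =o[atTop] (fun n : ℕ => (n : ℝ)) →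
      Tendsto (fun n => deviation (Fintype.card X) (Fintype.card ι) ε (r n) n) atTop (𝓝 0)) := by
  obtain ⟨htail, hlim⟩ := mainTheorem5_general.{_, _, 0} M hM
  refine ⟨fun n r hn _ σ ρ hρ ε hε => ?_, hlim (Fintype.card ι)⟩
  obtain ⟨hσ, hρ, hr, _, θ, R, hθ, hR, rfl, _, hsupp⟩ := hρ
  exact ((isPOVM_productPOVM hM n).eventProb_mono hρ.1 fun x =>
    (deviation_one_le _ (Fintype.card ι) ε r n).trans_lt).trans
      (htail (Nat.sub_add_cancel hr) hn σ θ R hσ.2 hθ hR hsupp ε hε)
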